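/- Let $B_2=\langle a,b : aba=a,\ bab=b,\ a^2=b^2=0\rangle$ be the five-element aperiodic Brandt semigroup (the presentation being one of semigroups with zero) and let $Y=B_2\setminus\{b\}=\{ab,a,ba,0\}$, a subsemigroup of $B_2$. A variety of semigroups is a class of semigroups closed under homomorphic images, subsemigroups and arbitrary direct products; it is proper if it is not the class of all semigroups. A class $\mathcal C$ of semigroups is epimorphically closed if, whenever $S\in\mathcal C$ and $\alpha:S\to T$ is an epimorphism in the category of semigroups (that is, a right-cancellable homomorphism), also $T\in\mathcal C$. There is no proper epimorphically closed variety of semigroups containing $Y$. -/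

import Mathlib

universe u

/-- The five elements of the aperiodic Brandt semigroup
`B₂ = ⟨a, b : aba = a, bab = b, a² = b² = 0⟩` (a presentation of semigroups with zero). -/
inductive BrandtB2 : Type
  | zero | a | b | ab | ba
  deriving DecidableEq

namespace BrandtB2

/-- The multiplication table of `B₂`. -/
def mul : BrandtB2 → BrandtB2 → BrandtB2
  | a, b => ab
  | a, ba => a
  | b, a => ba
  | b, ab => b
  | ab, a => a
  | ab, ab => ab
  | ba, b => b
  | ba, ba => ba
  | _, _ => zero

instance : Semigroup BrandtB2 where
  mul := mul
  mul_assoc := by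
    intro x y z
    cases x <;> cases y <;> cases z <;> rfl

/-- The semigroup `Y = B₂ \ {b} = {ab, a, ba, 0}`, as a subsemigroup of `B₂`. -/
def Y : Subsemigroup BrandtB2 where
  carrier := {x | x ≠ b}
  mul_mem' := by
    intro x y hx hy h
    change mul x y = b at h
    cases x <;> cases y <;> simp_all [mul]

end BrandtB2

/-- A variety of semigroups: a class of semigroups closed under taking homomorphic images,
subsemigroups, and direct products of arbitrary families. -/
structure IsSemigroupVariety (V : CategoryTheory.ObjectProperty Semigrp.{u}) : Prop where
  image : ∀ (S T : Semigrp.{u}) (f : S →ₙ* T), Function.Surjective f → V S → V T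
  sub : ∀ (S : Semigrp.{u}) (U : Subsemigroup S), V S → V (Semigrp.of U)
  prod : ∀ (ι : Type u) (S : ι → Semigrp.{u}), (∀ i, V (S i)) → V (Semigrp.of (∀ i, S i))

/-- A class of semigroups is epimorphically closed if it contains the codomain of every
epimorphism (in the category of all semigroups) whose domain belongs to the class. -/
def IsEpimorphicallyClosed (V : CategoryTheory.ObjectProperty Semigrp.{u}) : Prop :=
  ∀ (S T : Semigrp.{u}) (α : S ⟶ T), CategoryTheory.Epi α → V S → V T

open CategoryTheory

namespace IsSemigroupVariety

variable {V : ObjectProperty Semigrp.{u}}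

/-! Inverses in a groupoid are determined by the arrows they invert, so the two-object Brandt
semigroup over a group `G` is dominated by its zero, identities and one-way arrows
(`epi_subtype_parallel`). That small part embeds in the power `Y^G` (`toPower_injective`). An
epimorphically closed variety containing `Y` thus contains every group, hence every free semigroup,
as these embed in free groups, hence everything. -/

theorem of_injective (hV : IsSemigroupVariety V) {S T : Type u} [Semigroup S] [Semigroup T]
    (f : S →ₙ* T) (hf : Function.Injective f) (hT : V (Semigrp.of T)) : V (Semigrp.of S) := by
  have hU : V (Semigrp.of f.srange) := hV.sub (Semigrp.of T) f.srange hT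
  have key : ∀ x : f.srange, ∃ s, f s = x.1 := fun x => x.2
  choose g hg using key
  refine hV.image (Semigrp.of f.srange) (Semigrp.of S)
    { toFun := g, map_mul' := fun x y => hf ?_ } (fun s => ⟨⟨f s, s, rfl⟩, hf (hg _)⟩) hU
  rw [map_mul, hg, hg, hg]
  rfl

end IsSemigroupVariety

/-- The Brandt semigroup over the group `G` with two indices: the arrows `i → j` of the connected
groupoid with two objects and vertex group `G`, together with a zero. -/
inductive BrandtTwo (G : Type u) : Type u
  | zero
  | arrow (i : Bool) (g : G) (j : Bool)

namespace BrandtTwo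

variable {G : Type u}

open Classical in
/-- The coordinate at `g` of the embedding of the parallel arrows into a power of `Y`. -/
noncomputable def coordFun (g : G) : BrandtTwo G → BrandtB2
  | zero => .zero
  | arrow false _ false => .ab
  | arrow true _ true => .ba
  | arrow false h true => if h = g then .a else .zero
  | arrow true _ false => .zero

theorem coordFun_mem_Y (g : G) (x : BrandtTwo G) : coordFun g x ∈ BrandtB2.Y := by
  change coordFun g x ≠ .b
  rcases x with _ | ⟨_ | _, h, _ | _⟩ <;> simp [coordFun]
  split_ifs <;> simp

variable [Group G]

/-- Composition of arrows, with value zero where they are not composable. -/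
protected def mul : BrandtTwo G → BrandtTwo G → BrandtTwo G
  | arrow i g j, arrow k h l => if j = k then arrow i (g * h) l else zero
  | _, _ => zero

instance : Mul (BrandtTwo G) := ⟨BrandtTwo.mul⟩

@[simp] theorem zero_mul' (x : BrandtTwo G) : zero * x = zero := rfl

@[simp] theorem mul_zero' (x : BrandtTwo G) : x * zero = zero := by cases x <;> rfl

@[simp] theorem arrow_mul_arrow (i j k l : Bool) (g h : G) :
    arrow i g j * arrow k h l = if j = k then arrow i (g * h) l else zero := rfl

instance : Semigroup (BrandtTwo G) where
  mul_assoc x y z := by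
    rcases x with _ | ⟨i, g, j⟩ <;> rcases y with _ | ⟨k, h, l⟩ <;>
      rcases z with _ | ⟨m, p, n⟩ <;> simp
    by_cases h₁ : j = k <;> by_cases h₂ : l = m <;> simp [h₁, h₂, mul_assoc]

variable (G) in
/-- The zero, the two identities, and all arrows from `false` to `true`. -/
def parallel : Subsemigroup (BrandtTwo G) where
  carrier := {x | x = zero ∨ (∃ i, x = arrow i 1 i) ∨ ∃ g, x = arrow false g true}
  mul_mem' := by
    rintro x y (rfl | ⟨i, rfl⟩ | ⟨g, rfl⟩) (rfl | ⟨j, rfl⟩ | ⟨h, rfl⟩)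
    · simp
    · simp
    · simp
    · simp
    · cases i <;> cases j <;> simp
    · cases i <;> simp
    · simp
    · cases j <;> simp
    · simp

/-- Two one-way arrows never compose, so the multiplication of `G` plays no role: any map from these
arrows to `{a, 0}` would do. -/
theorem coordFun_mul (g : G) {x y : BrandtTwo G} (hx : x ∈ parallel G) (hy : y ∈ parallel G) :
    coordFun g (x * y) = coordFun g x * coordFun g y := by
  change _ = BrandtB2.mul _ _
  rcases hx with rfl | ⟨_ | _, rfl⟩ | ⟨p, rfl⟩ <;> rcases hy with rfl | ⟨_ | _, rfl⟩ | ⟨q, rfl⟩ <;>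
    simp [coordFun, BrandtB2.mul] <;> split_ifs <;> simp

variable (G) in
/-- The embedding of the parallel arrows into a power of `Y`. -/
noncomputable def toPower : parallel G →ₙ* (G → ULift.{u} BrandtB2.Y) where
  toFun x g := ⟨⟨coordFun g x, coordFun_mem_Y g x⟩⟩
  map_mul' x y := by
    funext g
    exact congrArg ULift.up (Subtype.ext (coordFun_mul g x.2 y.2))

theorem toPower_injective : Function.Injective (toPower G) := by
  rintro ⟨x, hx⟩ ⟨y, hy⟩ hxy
  have h (g : G) : coordFun g x = coordFun g y :=
    congrArg (fun z : ULift.{u} BrandtB2.Y => (z.down : BrandtB2)) (congrFun hxy g)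
  apply Subtype.ext
  change x = y
  rcases hx with rfl | ⟨_ | _, rfl⟩ | ⟨p, rfl⟩ <;> rcases hy with rfl | ⟨_ | _, rfl⟩ | ⟨q, rfl⟩ <;>
    -- An arrow labelled `p` is separated from zero and from other one-way arrows by coordinate `p`.
    first
    | rfl
    | simpa [coordFun] using h 1
    | simpa [coordFun, eq_comm] using h p
    | simpa [coordFun] using h q

/-- Homomorphisms from a Brandt semigroup are determined by their values on parallel arrows,
since inverses are. -/
theorem hom_ext {Z : Type u} [Semigroup Z] {φ ψ : BrandtTwo G →ₙ* Z}
    (h : ∀ x ∈ parallel G, φ x = ψ x) : φ = ψ := by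
  have hi (i : Bool) : φ (arrow i 1 i) = ψ (arrow i 1 i) := h _ (.inr (.inl ⟨i, rfl⟩))
  have hft (g : G) : φ (arrow false g true) = ψ (arrow false g true) :=
    h _ (.inr (.inr ⟨g, rfl⟩))
  have htf (g : G) : φ (arrow true g false) = ψ (arrow true g false) := by
    calc φ (arrow true g false)
        = φ (arrow true 1 true) * φ (arrow true g false) := by simp [← map_mul]
      -- Zigzag: the identity is factored through the forward arrow `g⁻¹`, on which `φ` and `ψ`
      -- agree.
      _ = ψ (arrow true g false * arrow false g⁻¹ true) * φ (arrow true g false) := by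
          rw [hi]; simp
      _ = ψ (arrow true g false) * φ (arrow false g⁻¹ true * arrow true g false) := by
          rw [map_mul, map_mul, hft, mul_assoc]
      _ = ψ (arrow true g false) * ψ (arrow false 1 false) := by rw [← hi]; simp
      _ = ψ (arrow true g false) := by simp [← map_mul]
  ext x
  rcases x with _ | ⟨_ | _, g, _ | _⟩
  · exact h _ (.inl rfl)
  · have e : (arrow false g false : BrandtTwo G) = arrow false g true * arrow true 1 false := by
      simp
    rw [e, map_mul, map_mul, hft, htf]
  · exact hft g
  · exact htf g
  · have e : (arrow true g true : BrandtTwo G) = arrow true g false * arrow false 1 true := by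
      simp
    rw [e, map_mul, map_mul, hft, htf]

theorem epi_subtype_parallel :
    Epi (Semigrp.ofHom (MulMemClass.subtype (parallel G))) where
  left_cancellation {Z} φ ψ h := by
    apply Semigrp.hom_ext
    refine hom_ext fun x hx => ?_
    exact DFunLike.congr_fun (congrArg Semigrp.Hom.hom h) (⟨x, hx⟩ : parallel G)

variable (G) in
/-- The vertex group at `false`. -/
def vertex : G →ₙ* BrandtTwo G where
  toFun g := arrow false g false
  map_mul' g h := by simp

theorem vertex_injective : Function.Injective (vertex G) := fun g h e => by
  simpa [vertex] using e

end BrandtTwo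

/-- Positive words are reduced, so by confluence distinct ones stay distinct in the free group. -/
theorem FreeSemigroup.toFreeGroup_injective (X : Type u) :
    Function.Injective (FreeSemigroup.lift (FreeGroup.of : X → FreeGroup X)) := by
  have hmk (w : FreeSemigroup X) : FreeSemigroup.lift (FreeGroup.of : X → FreeGroup X) w =
      FreeGroup.mk ((w.head :: w.tail).map fun x => (x, true)) := by
    induction w using FreeSemigroup.recOnMul with
    | ih1 x => simp [FreeGroup.of]
    | ih2 x y hx hy => rw [map_mul, hx, hy, FreeGroup.mul_mk]; simp
  have hred (l : List X) : FreeGroup.IsReduced (l.map fun x => (x, true)) := by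
    induction l using List.twoStepInduction with
    | nil => exact .nil
    | singleton x => exact .singleton
    | cons_cons x y l _ ih => exact FreeGroup.isReduced_cons_cons.2 ⟨fun _ => rfl, ih y⟩
  intro v w h
  rw [hmk, hmk] at h
  obtain ⟨L, hv, hw⟩ := FreeGroup.Red.exact.1 h
  rw [(hred _).red_iff_eq] at hv hw
  have hvw := List.map_injective_iff.2 (fun x y hxy => congrArg Prod.fst hxy) (hv.symm.trans hw)
  exact FreeSemigroup.ext (List.cons.inj hvw).1 (List.cons.inj hvw).2

namespace IsSemigroupVariety

variable {V : ObjectProperty Semigrp.{u}}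

theorem group_mem (hV : IsSemigroupVariety V) (hE : IsEpimorphicallyClosed V)
    (hY : V (Semigrp.of (ULift.{u} BrandtB2.Y))) (G : Type u) [Group G] : V (Semigrp.of G) :=
  hV.of_injective (BrandtTwo.vertex G) BrandtTwo.vertex_injective <|
    hE _ _ _ BrandtTwo.epi_subtype_parallel <|
      hV.of_injective (BrandtTwo.toPower G) BrandtTwo.toPower_injective <|
        hV.prod G (fun _ => Semigrp.of (ULift.{u} BrandtB2.Y)) fun _ => hY

theorem mem_of_forall_group (hV : IsSemigroupVariety V)
    (hG : ∀ (G : Type u) [Group G], V (Semigrp.of G)) (S : Semigrp.{u}) : V S :=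
  hV.image (Semigrp.of (FreeSemigroup S)) S (FreeSemigroup.lift id)
    (fun s => ⟨FreeSemigroup.of s, FreeSemigroup.lift_of id s⟩) <|
    hV.of_injective _ (FreeSemigroup.toFreeGroup_injective S) (hG (FreeGroup S))

end IsSemigroupVariety

theorem corollaryc :
    ¬ ∃ V : CategoryTheory.ObjectProperty Semigrp.{u},
      IsSemigroupVariety V ∧ IsEpimorphicallyClosed V ∧
        V (Semigrp.of (ULift.{u} BrandtB2.Y)) ∧ ∃ S : Semigrp.{u}, ¬ V S := by
  rintro ⟨V, hV, hE, hY, S, hS⟩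
  exact hS (hV.mem_of_forall_group (fun G => hV.group_mem hE hY G) S)
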